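/- Let $\Delta=\{z\in\mathbb C:|z|<1\}$ and let $\mathcal A$ be the class of functions $f$ analytic in $\Delta$ with $f(0)=0$ and $f'(0)=1$. For functions $g,h$ on $\Delta$ write $g\prec h$ if there is an analytic function $w$ on $\Delta$ with $w(0)=0$, $|w(z)|<1$ and $g(z)=h(w(z))$ for all $z\in\Delta$. For $0\le\alpha<1$ let $\mathcal{BS}(\alpha)$ be the class of all $f\in\mathcal A$ such that $$\frac{zf'(z)}{f(z)}-1\prec\frac{z}{1-\alpha z^2}\qquad(z\in\Delta).$$ (The functions $zf'(z)/f(z)$ and $f(z)/z$ take their limit value $1$ at $z=0$.) Let $0\le\alpha\le 3-2\sqrt2$, $f\in\mathcal{BS}(\alpha)$ and $|z|=r<1$. Then $$\left(\frac{1-r\sqrt\alpha}{1+r\sqrt\alpha}\right)^{\frac1{2\sqrt\alpha}}\le\operatorname{Re}\frac{f(z)}{z}\le\left(\frac{1+r\sqrt\alpha}{1-r\sqrt\alpha}\right)^{\frac1{2\sqrt\alpha}},$$ where for $\alpha=0$ the two bounds are read as their limits $e^{-r}$ and $e^{r}$. The result is sharp: the function $$\tilde f(z)=z\left(\frac{1+z\sqrt\alpha}{1-z\sqrt\alpha}\right)^{\frac1{2\sqrt\alpha}}$$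 (principal branch; $\tilde f(z)=ze^z$ for $\alpha=0$) belongs to $\mathcal{BS}(\alpha)$, and for every $0\le r<1$ equality holds on the left for $f=\tilde f$, $z=-r$ and on the right for $f=\tilde f$, $z=r$. -/

import Mathlib

noncomputable section

/-- The open unit disc in the complex plane. -/
def unitDisc : Set ℂ := {z : ℂ | ‖z‖ < 1}

/-- The class of functions analytic in the unit disc and normalized by `f 0 = 0`, `f' 0 = 1`. -/
def ClassA : Set (ℂ → ℂ) :=
  {f | DifferentiableOn ℂ f unitDisc ∧ f 0 = 0 ∧ deriv f 0 = 1}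

/-- The Schwarz functions: `w` analytic in the unit disc, `w 0 = 0`, and `|w z| < 1` there. -/
def SchwarzClass : Set (ℂ → ℂ) :=
  {w | DifferentiableOn ℂ w unitDisc ∧ w 0 = 0 ∧ ∀ z ∈ unitDisc, ‖w z‖ < 1}

/-- Subordination `f ≺ g` in the unit disc. -/
def Subordinate (f g : ℂ → ℂ) : Prop :=
  ∃ w ∈ SchwarzClass, ∀ z ∈ unitDisc, f z = g (w z)

/-- The function `z f'(z) / f(z) - 1`. Its singularity at the origin is removable for `f` in
`ClassA`, with value `0`. -/
def starQuotSubOne (f : ℂ → ℂ) (z : ℂ) : ℂ :=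
  if z = 0 then 0 else z * deriv f z / f z - 1

/-- The function `z / (1 - α z²)` that maps the unit disc onto the interior of a
Booth lemniscate. -/
def boothF (α : ℝ) (z : ℂ) : ℂ := z / (1 - (α : ℂ) * z ^ 2)

/-- The class `BS(α)`. (For `0 ≤ α < 1` the function `boothF α` is bounded on the unit disc, so the
subordination already forces `f` to have no zero in the punctured disc.) -/
def BS (α : ℝ) : Set (ℂ → ℂ) :=
  {f | f ∈ ClassA ∧ Subordinate (starQuotSubOne f) (boothF α)}

/-- The function `f(z) / z`, with its singularity at the origin (for `f 0 = 0`) removed. -/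
def quotByZ (f : ℂ → ℂ) (z : ℂ) : ℂ :=
  if z = 0 then deriv f 0 else f z / z

/-- The function `((1 + z √α) / (1 - z √α)) ^ (1 / (2 √α))` (principal branch), read as its limit
`exp z` when `α = 0`. -/
def extremalF (α : ℝ) (z : ℂ) : ℂ :=
  if α = 0 then Complex.exp z
  else ((1 + z * (Real.sqrt α : ℂ)) / (1 - z * (Real.sqrt α : ℂ))) ^
    (1 / (2 * (Real.sqrt α : ℂ)))

/-- The extremal function `z ((1 + z √α) / (1 - z √α)) ^ (1 / (2 √α))`. -/
def extremalFun (α : ℝ) (z : ℂ) : ℂ := z * extremalF α z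

/-- `((1 - r √α) / (1 + r √α)) ^ (1 / (2 √α))`, read as its limit `exp (-r)` when `α = 0`. -/
def lowerBoundBS (α r : ℝ) : ℝ :=
  if α = 0 then Real.exp (-r)
  else ((1 - r * Real.sqrt α) / (1 + r * Real.sqrt α)) ^ (1 / (2 * Real.sqrt α))

/-- `((1 + r √α) / (1 - r √α)) ^ (1 / (2 √α))`, read as its limit `exp r` when `α = 0`. -/
def upperBoundBS (α r : ℝ) : ℝ :=
  if α = 0 then Real.exp r
  else ((1 + r * Real.sqrt α) / (1 - r * Real.sqrt α)) ^ (1 / (2 * Real.sqrt α))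

end

/-! Write `f z / z = exp (g z)`; by Schwarz's lemma `z g'(z)` lies in the image under `boothF α` of
the closed disc of radius `‖z‖` (`BS.exists_log`). For `‖ζ‖ ≤ ρ` that image lies in the convex hull
of two discs of radius `ρ` centred at `±(boothF α ρ - ρ)`; `boothF_re_im_bound` states this through
support functions. Support functions integrate along rays (`re_mul_log_le`), so with `L = log
(upperBoundBS α r)` the values of `g` on `‖z‖ = r` lie in the hull of two discs of radius `r`
centred at `±(L - r)`.

The upper bound follows from `Re g ≤ L`. For the lower one, `exp (-L) ≤ Re (exp w)` reads `Re w ≥ -L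
- log (cos (Im w))`. Testing the hull in the direction normal to this boundary curve at height `Im
w` reduces the claim to a one-variable inequality (`exp_neg_le_re_exp`). -/

/-! ### A one-variable cosine inequality -/

theorem cos_mul_log_cos_add_nonneg {y : ℝ} (h0 : 0 ≤ y) (h1 : y ≤ 1) :
    0 ≤ Real.cos y * Real.log (Real.cos y) + y * Real.sin y + Real.cos y - 1 := by
  have hcos : ∀ t ∈ Set.Icc (0 : ℝ) 1, 0 < Real.cos t := fun t ht =>
    Real.cos_pos_of_mem_Ioo ⟨by linarith [ht.1, Real.pi_gt_three], by linarith [ht.2, Real.pi_gt_three]⟩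
  have hlog : ∀ t ∈ Set.Icc (0 : ℝ) 1, HasDerivAt (fun t => Real.log (Real.cos t))
      (-Real.sin t / Real.cos t) t := fun t ht => (Real.hasDerivAt_cos t).log (hcos t ht).ne'
  -- This is the derivative of the target divided by `cos t`; it vanishes at `0` and increases
  -- because `log (cos t) ≤ 0`.
  have hχ : ∀ t ∈ Set.Icc (0 : ℝ) 1,
      0 ≤ t - Real.tan t - Real.tan t * Real.log (Real.cos t) := by
    have hd : ∀ t ∈ Set.Icc (0 : ℝ) 1, HasDerivAt
        (fun t => t - Real.tan t - Real.tan t * Real.log (Real.cos t))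
        (-Real.log (Real.cos t) / Real.cos t ^ 2) t := by
      intro t ht
      have hc := (hcos t ht).ne'
      convert! ((hasDerivAt_id t).sub (Real.hasDerivAt_tan hc)).sub
        ((Real.hasDerivAt_tan hc).mul (hlog t ht)) using 1
      rw [Real.tan_eq_sin_div_cos]
      field_simp
      linear_combination -Real.sin_sq_add_cos_sq t
    have hm : MonotoneOn (fun t => t - Real.tan t - Real.tan t * Real.log (Real.cos t))
        (Set.Icc (0 : ℝ) 1) := by
      apply monotoneOn_of_deriv_nonneg (convex_Icc 0 1)
      · exact fun t ht => (hd t ht).continuousAt.continuousWithinAt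
      · exact fun t ht => (hd t (interior_subset ht)).differentiableAt.differentiableWithinAt
      · intro t ht
        rw [(hd t (interior_subset ht)).deriv]
        have := Real.log_nonpos (hcos t (interior_subset ht)).le (Real.cos_le_one t)
        exact div_nonneg (by linarith) (sq_nonneg _)
    intro t ht
    simpa using hm ⟨le_rfl, zero_le_one⟩ ht ht.1
  have hd : ∀ t ∈ Set.Icc (0 : ℝ) 1, HasDerivAt
      (fun t => Real.cos t * Real.log (Real.cos t) + t * Real.sin t + Real.cos t - 1)
      (Real.cos t * (t - Real.tan t - Real.tan t * Real.log (Real.cos t))) t := by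
    intro t ht
    have hc := (hcos t ht).ne'
    convert! ((((Real.hasDerivAt_cos t).mul (hlog t ht)).add
      ((hasDerivAt_id t).mul (Real.hasDerivAt_sin t))).add (Real.hasDerivAt_cos t)).sub_const 1 using 1
    rw [Real.tan_eq_sin_div_cos]
    simp only [id]
    field_simp
    ring
  have hm : MonotoneOn
      (fun t => Real.cos t * Real.log (Real.cos t) + t * Real.sin t + Real.cos t - 1)
      (Set.Icc (0 : ℝ) 1) := by
    apply monotoneOn_of_deriv_nonneg (convex_Icc 0 1)
    · exact fun t ht => (hd t ht).continuousAt.continuousWithinAt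
    · exact fun t ht => (hd t (interior_subset ht)).differentiableAt.differentiableWithinAt
    · intro t ht
      rw [(hd t (interior_subset ht)).deriv]
      exact mul_nonneg (hcos t (interior_subset ht)).le (hχ t (interior_subset ht))
  simpa using hm ⟨le_rfl, zero_le_one⟩ ⟨h0, h1⟩ h0

/-! ### Convex hull of the image of a disc -/

/-- The image is symmetric in both axes, so absolute values reduce to the first quadrant; there one
disc contains it, and Cauchy–Schwarz gives the support bound. -/
theorem boothF_re_im_bound {α ρ : ℝ} {ζ c : ℂ} (hα : 0 ≤ α) (hα' : α ≤ 1 / 5)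
    (hζ : ‖ζ‖ ≤ ρ) (hρ : ρ < 1) (hc : ‖c‖ = 1) :
    (c * boothF α ζ).re ≤ |c.re| * (ρ * (1 / (1 - α * ρ ^ 2) - 1)) + ρ := by
  set σ := ‖ζ‖ with hσ
  have hσ0 : 0 ≤ σ := norm_nonneg ζ
  have hσ2 : σ ^ 2 = ζ.re ^ 2 + ζ.im ^ 2 := by
    rw [hσ, Complex.sq_norm, Complex.normSq_apply]; ring
  have hc2 : c.re ^ 2 + c.im ^ 2 = 1 := by
    have := Complex.sq_norm c
    rw [hc, Complex.normSq_apply] at this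
    linarith
  set x := α * σ ^ 2 with hx
  have hx0 : 0 ≤ x := by positivity
  have hσρ : σ ^ 2 ≤ ρ ^ 2 := by gcongr
  have hρ1 : ρ ^ 2 < 1 := by nlinarith
  have hxρ : x ≤ α * ρ ^ 2 := by rw [hx]; gcongr
  have hαρ : α * ρ ^ 2 ≤ 1 / 5 := by nlinarith
  have hx1 : x ≤ 1 / 5 := hxρ.trans hαρ
  set X := |ζ.re| with hX
  have hX0 : 0 ≤ X := abs_nonneg _
  have hX2 : X ^ 2 = ζ.re ^ 2 := sq_abs _
  have hXσ : X ≤ σ := Complex.abs_re_le_norm ζ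
  set N := (1 + x) ^ 2 - 4 * α * X ^ 2 with hN
  have hNpos : 0 < N := by
    have : α * X ^ 2 ≤ x := by rw [hx]; gcongr
    nlinarith
  have hnsq : Complex.normSq (1 - (α : ℂ) * ζ ^ 2) = N := by
    rw [hN, hX2, hx, hσ2, Complex.normSq_apply]
    simp [pow_two]
    ring
  have hre : (boothF α ζ).re = ζ.re * (1 - x) / N := by
    rw [boothF, Complex.div_re, hnsq, ← add_div, hx, hσ2]
    congr 1
    simp [pow_two]
    ring
  have him : (boothF α ζ).im = ζ.im * (1 + x) / N := by
    rw [boothF, Complex.div_im, hnsq, ← sub_div, hx, hσ2]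
    congr 1
    simp [pow_two]
    ring
  have hsum : (boothF α ζ).re ^ 2 + (boothF α ζ).im ^ 2 = σ ^ 2 / N := by
    rw [hre, him]
    field_simp
    rw [hN, hX2, hx, hσ2]
    ring
  have hare : |(boothF α ζ).re| = X * (1 - x) / N := by
    rw [hre, abs_div, abs_mul, abs_of_pos hNpos, abs_of_nonneg (show 0 ≤ 1 - x by linarith)]
  -- the first-quadrant part of the image lies in a disc of radius `σ`
  have hpoly : (σ ^ 2 - 2 * σ * x * X) * (1 - x) ^ 2 ≤ σ ^ 2 * (1 - 2 * x) * N := by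
    -- Both coefficients are nonnegative since `x ≤ 1/5 < √2 - 1`; this is where the smallness of
    -- `α` enters.
    have e : σ ^ 2 * (1 - 2 * x) * N - (σ ^ 2 - 2 * σ * x * X) * (1 - x) ^ 2 =
        2 * x * (1 - 2 * x - x ^ 2) * (σ * (σ - X)) + 4 * x * (1 - 2 * x) * (X * (σ - X)) := by
      rw [hN, hx]; ring
    have h1 : 0 ≤ σ * (σ - X) := mul_nonneg hσ0 (by linarith)
    have h2 : 0 ≤ X * (σ - X) := mul_nonneg hX0 (by linarith)
    have h3 : 0 ≤ 1 - 2 * x - x ^ 2 := by nlinarith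
    have h4 : 0 ≤ 1 - 2 * x := by linarith
    have : 0 ≤ 2 * x * (1 - 2 * x - x ^ 2) * (σ * (σ - X)) +
      4 * x * (1 - 2 * x) * (X * (σ - X)) := by positivity
    linarith
  have h1x : 0 < 1 - x := by linarith
  have hdisc : (|(boothF α ζ).re| - σ * (1 / (1 - x) - 1)) ^ 2 + |(boothF α ζ).im| ^ 2 ≤ σ ^ 2 := by
    have e : (|(boothF α ζ).re| - σ * (1 / (1 - x) - 1)) ^ 2 + |(boothF α ζ).im| ^ 2 =
        σ ^ 2 + ((σ ^ 2 - 2 * σ * x * X) * (1 - x) ^ 2 - σ ^ 2 * (1 - 2 * x) * N) /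
          (N * (1 - x) ^ 2) := by
      rw [sub_sq, sq_abs, sq_abs]
      have : (boothF α ζ).im ^ 2 = σ ^ 2 / N - (boothF α ζ).re ^ 2 := by linarith
      rw [this, hare]
      field_simp
      ring
    rw [e]
    have : ((σ ^ 2 - 2 * σ * x * X) * (1 - x) ^ 2 - σ ^ 2 * (1 - 2 * x) * N) /
          (N * (1 - x) ^ 2) ≤ 0 := div_nonpos_of_nonpos_of_nonneg (by linarith) (by positivity)
    linarith
  have hmul : (c * boothF α ζ).re ≤
      |c.re| * |(boothF α ζ).re| + |c.im| * |(boothF α ζ).im| := by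
    rw [Complex.mul_re, ← abs_mul, ← abs_mul]
    linarith [le_abs_self (c.re * (boothF α ζ).re), neg_abs_le (c.im * (boothF α ζ).im)]
  have hcs : |c.re| * (|(boothF α ζ).re| - σ * (1 / (1 - x) - 1)) +
      |c.im| * |(boothF α ζ).im| ≤ σ := by
    refine le_of_abs_le (abs_le_of_sq_le_sq ?_ hσ0)
    set a := |(boothF α ζ).re| - σ * (1 / (1 - x) - 1)
    set b := |(boothF α ζ).im|
    have hp : |c.re| ^ 2 + |c.im| ^ 2 = 1 := by rw [sq_abs, sq_abs, hc2]
    have : (|c.re| * a + |c.im| * b) ^ 2 + (|c.re| * b - |c.im| * a) ^ 2 = a ^ 2 + b ^ 2 := by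
      linear_combination (a ^ 2 + b ^ 2) * hp
    linarith [sq_nonneg (|c.re| * b - |c.im| * a)]
  have hmono : σ * (1 / (1 - x) - 1) ≤ ρ * (1 / (1 - α * ρ ^ 2) - 1) := by
    apply mul_le_mul hζ _ _ (hσ0.trans hζ)
    · exact sub_le_sub_right (one_div_le_one_div_of_le (by linarith) (by linarith)) 1
    · rw [sub_nonneg, le_div_iff₀ h1x]; linarith
  have := mul_le_mul_of_nonneg_left hmono (abs_nonneg c.re)
  linarith

/-! ### The logarithm of `f z / z` -/

theorem unitDisc_eq_ball : unitDisc = Metric.ball (0 : ℂ) 1 := by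
  ext z; simp [unitDisc]

theorem isOpen_unitDisc : IsOpen unitDisc := unitDisc_eq_ball ▸ Metric.isOpen_ball

theorem quotByZ_eq_dslope {f : ℂ → ℂ} (hf : f 0 = 0) : quotByZ f = dslope f 0 := by
  funext z
  by_cases hz : z = 0
  · simp [quotByZ, hz]
  · rw [quotByZ, if_neg hz, dslope_of_ne _ hz, slope_def_field, hf, sub_zero, sub_zero]

theorem one_sub_mul_sq_ne_zero {α : ℝ} {z : ℂ} (hα : 0 ≤ α) (hα' : α < 1) (hz : z ∈ unitDisc) :
    1 - (α : ℂ) * z ^ 2 ≠ 0 := by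
  have hz : ‖z‖ < 1 := hz
  intro h
  have h1 : ‖(α : ℂ) * z ^ 2‖ = 1 := by rw [← sub_eq_zero.mp h, norm_one]
  rw [norm_mul, norm_pow, Complex.norm_real, Real.norm_of_nonneg hα] at h1
  nlinarith [norm_nonneg z, mul_nonneg hα (sq_nonneg ‖z‖)]

theorem differentiableOn_boothF {α : ℝ} (hα : 0 ≤ α) (hα' : α < 1) :
    DifferentiableOn ℂ (boothF α) unitDisc := by
  unfold boothF
  exact differentiableOn_id.div (by fun_prop) fun z hz => one_sub_mul_sq_ne_zero hα hα' hz

/-- A function `f` of class `BS α` satisfies `f z / z = exp (g z)`, where `z g'(z)` takes values of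
`boothF α` on the closed disc of radius `‖z‖`. -/
theorem BS.exists_log {α : ℝ} (hα : 0 ≤ α) (hα' : α < 1) {f : ℂ → ℂ} (hf : f ∈ BS α) :
    ∃ g k : ℂ → ℂ, g 0 = 0 ∧ (∀ z ∈ unitDisc, HasDerivAt g (k z) z) ∧
      (∀ z ∈ unitDisc, quotByZ f z = Complex.exp (g z)) ∧
      ∀ z ∈ unitDisc, ∃ ζ : ℂ, ‖ζ‖ ≤ ‖z‖ ∧ z * k z = boothF α ζ := by
  obtain ⟨⟨hfd, hf0, hf1⟩, w, ⟨hwd, hw0, hw1⟩, hsub⟩ := hf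
  have h0 : (0 : ℂ) ∈ unitDisc := by simp [unitDisc]
  have hnhds : ∀ z ∈ unitDisc, unitDisc ∈ nhds z := fun z hz => isOpen_unitDisc.mem_nhds hz
  have hFw : DifferentiableOn ℂ (fun z => boothF α (w z)) unitDisc :=
    (differentiableOn_boothF hα hα').comp hwd fun z hz => hw1 z hz
  set k := dslope (fun z => boothF α (w z)) 0 with hk
  set q := dslope f 0 with hq
  have hkd : DifferentiableOn ℂ k unitDisc :=
    (Complex.differentiableOn_dslope (hnhds 0 h0)).mpr hFw
  have hqd : DifferentiableOn ℂ q unitDisc :=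
    (Complex.differentiableOn_dslope (hnhds 0 h0)).mpr hfd
  have hzk : ∀ z, z * k z = boothF α (w z) := fun z => by
    have := sub_smul_dslope (fun z => boothF α (w z)) 0 z
    have hF0 : boothF α 0 = 0 := by simp [boothF]
    simpa [hw0, hF0] using this
  have hzq : ∀ z, f z = z * q z := fun z => by
    have := sub_smul_dslope f 0 z
    simpa [hf0] using this.symm
  -- Dividing by `f z` is safe only near `0`; the identity theorem extends the equation to the disc,
  -- so no zero-freeness of `f` is needed beforehand.
  have hode : Set.EqOn (deriv q) (fun z => q z * k z) unitDisc := by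
    apply AnalyticOnNhd.eqOn_of_preconnected_of_frequently_eq (z₀ := 0)
      ((hqd.deriv isOpen_unitDisc).analyticOnNhd isOpen_unitDisc)
      ((hqd.fun_mul hkd).analyticOnNhd isOpen_unitDisc)
      (unitDisc_eq_ball ▸ (convex_ball (0 : ℂ) 1).isPreconnected) h0
    apply Filter.Eventually.frequently
    have hne : ∀ᶠ z in nhdsWithin (0 : ℂ) {0}ᶜ, f z ≠ 0 := by
      have hd : HasDerivAt f 1 0 := hf1 ▸ (hfd.differentiableAt (hnhds 0 h0)).hasDerivAt
      exact hd.eventually_ne one_ne_zero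
    filter_upwards [hne, self_mem_nhdsWithin, mem_nhdsWithin_of_mem_nhds (hnhds 0 h0)]
      with z hz hz0 hzD
    have hz0 : z ≠ 0 := hz0
    have hd : deriv f z = q z + z * deriv q z := by
      rw [show f = fun z => z * q z from funext hzq]
      have := (hasDerivAt_id' z).fun_mul (hqd.differentiableAt (hnhds z hzD)).hasDerivAt
      simpa using this.deriv
    have h := hsub z hzD
    rw [starQuotSubOne, if_neg hz0, ← hzk, sub_eq_iff_eq_add, div_eq_iff hz, hd, hzq z] at h
    apply mul_left_cancel₀ (pow_ne_zero 2 hz0)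
    linear_combination h
  obtain ⟨g, hg0, hg⟩ : ∃ g : ℂ → ℂ, g 0 = 0 ∧ ∀ z ∈ unitDisc, HasDerivAt g (k z) z := by
    obtain ⟨g, hg⟩ := (DifferentiableOn.isExactOn_ball (c := 0) (r := 1)
      (unitDisc_eq_ball ▸ hkd))
    refine ⟨fun z => g z - g 0, sub_self _, fun z hz => ?_⟩
    exact (hg z (unitDisc_eq_ball ▸ hz)).sub_const _
  refine ⟨g, k, hg0, hg, fun z hz => ?_, fun z hz => ⟨w z, ?_, hzk z⟩⟩
  · have hder : ∀ z ∈ unitDisc, HasDerivAt (fun z => q z * Complex.exp (-g z)) 0 z := by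
      intro z hz
      convert! (hqd.differentiableAt (hnhds z hz)).hasDerivAt.mul (hg z hz).neg.cexp using 1
      rw [hode hz]
      ring
    have hconst : q z * Complex.exp (-g z) = q 0 * Complex.exp (-g 0) := by
      apply (convex_ball (0 : ℂ) 1).is_const_of_fderivWithin_eq_zero (𝕜 := ℂ)
        (f := fun z => q z * Complex.exp (-g z)) _ _ (unitDisc_eq_ball ▸ hz) (unitDisc_eq_ball ▸ h0)
      · rw [← unitDisc_eq_ball]
        exact fun z hz => (hder z hz).differentiableAt.differentiableWithinAt
      · rw [← unitDisc_eq_ball]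
        intro z hz
        rw [fderivWithin_of_isOpen isOpen_unitDisc hz]
        ext
        simpa using (hder z hz).deriv
    rw [quotByZ_eq_dslope hf0, ← hq]
    have hq0 : q 0 = 1 := by rw [hq, dslope_same, hf1]
    rw [hg0, hq0, neg_zero, Complex.exp_zero, one_mul, Complex.exp_neg] at hconst
    rwa [mul_inv_eq_one₀ (Complex.exp_ne_zero _)] at hconst
  · apply Complex.norm_le_norm_of_mapsTo_ball (R := 1) (unitDisc_eq_ball ▸ hwd) _ hw0 hz
    intro u hu
    rw [mem_closedBall_zero_iff]
    exact (hw1 u (unitDisc_eq_ball ▸ hu)).le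

/-! ### The real bounds -/

theorem sqrt_lt_one_of_lt_one {α : ℝ} (hα' : α < 1) : Real.sqrt α < 1 := by
  rw [Real.sqrt_lt' one_pos]; linarith

theorem upperBoundBS_base_pos {α r : ℝ} (hα' : α < 1) (hr0 : 0 ≤ r) (hr : r < 1) :
    0 < 1 - r * Real.sqrt α := by
  nlinarith [Real.sqrt_nonneg α, sqrt_lt_one_of_lt_one hα']

theorem upperBoundBS_pos {α r : ℝ} (hα' : α < 1) (hr0 : 0 ≤ r) (hr : r < 1) :
    0 < upperBoundBS α r := by
  have h := upperBoundBS_base_pos hα' hr0 hr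
  have := Real.sqrt_nonneg α
  unfold upperBoundBS
  split_ifs <;> positivity

theorem lowerBoundBS_eq_inv {α r : ℝ} (hα' : α < 1) (hr0 : 0 ≤ r) (hr : r < 1) :
    lowerBoundBS α r = (upperBoundBS α r)⁻¹ := by
  have h := upperBoundBS_base_pos hα' hr0 hr
  have := Real.sqrt_nonneg α
  unfold lowerBoundBS upperBoundBS
  split_ifs
  · exact Real.exp_neg r
  · rw [← Real.inv_rpow (by positivity), inv_div]

/-- Identifies the radial integral of `boothF α ρ / ρ` as the logarithm of the upper bound. -/
theorem hasDerivAt_log_upperBoundBS {α r : ℝ} (hα : 0 ≤ α) (hα' : α < 1) (hr0 : 0 ≤ r)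
    (hr : r < 1) :
    HasDerivAt (fun r => Real.log (upperBoundBS α r)) (1 / (1 - α * r ^ 2)) r := by
  by_cases h0 : α = 0
  · simpa [upperBoundBS, h0] using hasDerivAt_id' r
  have hs : 0 < Real.sqrt α := Real.sqrt_pos.mpr (lt_of_le_of_ne hα (Ne.symm h0))
  have hsq := Real.sq_sqrt hα
  have h := upperBoundBS_base_pos hα' hr0 hr
  simp only [upperBoundBS, if_neg h0]
  set s := Real.sqrt α
  have h1 : 0 < 1 + r * s := by positivity
  have hn : HasDerivAt (fun r => 1 + r * s) s r := by
    simpa using ((hasDerivAt_id r).mul_const s).const_add 1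
  have hd : HasDerivAt (fun r => 1 - r * s) (-s) r := by
    simpa using ((hasDerivAt_id r).mul_const s).const_sub 1
  have hq : HasDerivAt (fun r => 1 / (2 * s) * Real.log ((1 + r * s) / (1 - r * s)))
      (1 / (1 - α * r ^ 2)) r := by
    convert! ((hn.fun_div hd h.ne').log (div_pos h1 h).ne').const_mul (1 / (2 * s)) using 1
    have e : 1 - α * r ^ 2 = (1 + r * s) * (1 - r * s) := by rw [← hsq]; ring
    rw [e]
    field_simp
    ring
  refine hq.congr_of_eventuallyEq ?_
  have : ∀ᶠ t in nhds r, 0 < (1 + t * s) / (1 - t * s) :=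
    (hn.continuousAt.div hd.continuousAt h.ne').eventually_const_lt (div_pos h1 h)
  filter_upwards [this] with t ht
  exact Real.log_rpow ht _

theorem log_upperBoundBS_zero (α : ℝ) : Real.log (upperBoundBS α 0) = 0 := by
  unfold upperBoundBS
  split_ifs <;> simp

/-! ### The extremal function -/

theorem mul_sqrt_norm_lt_one {α : ℝ} (hα' : α < 1) {z : ℂ} (hz : z ∈ unitDisc) :
    ‖z * (Real.sqrt α : ℂ)‖ < 1 := by
  have hz : ‖z‖ < 1 := hz
  rw [norm_mul, Complex.norm_real, Real.norm_of_nonneg (Real.sqrt_nonneg α)]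
  nlinarith [Real.sqrt_nonneg α, sqrt_lt_one_of_lt_one hα', norm_nonneg z]

theorem one_add_div_one_sub_mem_slitPlane {u : ℂ} (hu : ‖u‖ < 1) :
    (1 + u) / (1 - u) ∈ Complex.slitPlane := by
  have hne : 1 - u ≠ 0 := by
    intro h
    rw [← sub_eq_zero.mp h, norm_one] at hu
    exact lt_irrefl _ hu
  left
  have hn : u.re ^ 2 + u.im ^ 2 < 1 := by
    have := Complex.sq_norm u
    rw [Complex.normSq_apply] at this
    nlinarith [norm_nonneg u]
  rw [Complex.div_re, ← add_div]
  apply div_pos _ (Complex.normSq_pos.mpr hne)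
  simp
  nlinarith

theorem extremalF_zero (α : ℝ) : extremalF α 0 = 1 := by
  unfold extremalF
  split_ifs <;> simp

theorem extremalF_ne_zero {α : ℝ} (hα' : α < 1) {z : ℂ} (hz : z ∈ unitDisc) :
    extremalF α z ≠ 0 := by
  unfold extremalF
  split_ifs
  · exact Complex.exp_ne_zero z
  · intro h
    exact Complex.slitPlane_ne_zero
      (one_add_div_one_sub_mem_slitPlane (mul_sqrt_norm_lt_one hα' hz))
      (Complex.cpow_eq_zero_iff _ _ |>.mp h).1

theorem hasDerivAt_extremalF {α : ℝ} (hα : 0 ≤ α) (hα' : α < 1) {z : ℂ} (hz : z ∈ unitDisc) :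
    HasDerivAt (extremalF α) (extremalF α z / (1 - (α : ℂ) * z ^ 2)) z := by
  by_cases h0 : α = 0
  · have e : extremalF α = Complex.exp := by funext z; simp [extremalF, h0]
    rw [e]
    simpa [h0] using Complex.hasDerivAt_exp z
  have hs : (Real.sqrt α : ℂ) ≠ 0 := by
    rw [Complex.ofReal_ne_zero]
    exact (Real.sqrt_pos.mpr (lt_of_le_of_ne hα (Ne.symm h0))).ne'
  have hsq : (Real.sqrt α : ℂ) ^ 2 = (α : ℂ) := by
    rw [← Complex.ofReal_pow, Real.sq_sqrt hα]
  have hm := one_add_div_one_sub_mem_slitPlane (mul_sqrt_norm_lt_one hα' hz)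
  have e : extremalF α = fun z => ((1 + z * (Real.sqrt α : ℂ)) / (1 - z * (Real.sqrt α : ℂ))) ^
    (1 / (2 * (Real.sqrt α : ℂ))) := by funext z; simp only [extremalF, if_neg h0]
  rw [e]
  set s := (Real.sqrt α : ℂ)
  have hq := Complex.slitPlane_ne_zero hm
  have h1 : 1 + z * s ≠ 0 := fun h => hq (by rw [h, zero_div])
  have h2 : 1 - z * s ≠ 0 := fun h => hq (by rw [h, div_zero])
  have hn : HasDerivAt (fun z => 1 + z * s) s z := by
    simpa using ((hasDerivAt_id z).mul_const s).const_add 1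
  have hd : HasDerivAt (fun z => 1 - z * s) (-s) z := by
    simpa using ((hasDerivAt_id z).mul_const s).const_sub 1
  convert! (hn.fun_div hd h2).cpow_const (c := 1 / (2 * s)) hm using 1
  rw [Complex.cpow_sub _ _ hq, Complex.cpow_one]
  have e : 1 - (α : ℂ) * z ^ 2 = (1 + z * s) * (1 - z * s) := by rw [← hsq]; ring
  rw [e]
  field_simp
  ring

theorem quotByZ_extremalFun {α : ℝ} (hα : 0 ≤ α) (hα' : α < 1) (z : ℂ) :
    quotByZ (extremalFun α) z = extremalF α z := by
  unfold quotByZ extremalFun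
  split_ifs with hz
  · have := (hasDerivAt_id' (0 : ℂ)).fun_mul
      (hasDerivAt_extremalF hα hα' (z := 0) (by simp [unitDisc]))
    simpa [hz, extremalF_zero] using this.deriv
  · rw [mul_div_cancel_left₀ _ hz]

theorem extremalFun_mem_BS {α : ℝ} (hα : 0 ≤ α) (hα' : α < 1) : extremalFun α ∈ BS α := by
  have hd : ∀ z ∈ unitDisc, HasDerivAt (extremalFun α)
      (extremalF α z + z * (extremalF α z / (1 - (α : ℂ) * z ^ 2))) z := fun z hz => by
    unfold extremalFun
    simpa using (hasDerivAt_id' z).fun_mul (hasDerivAt_extremalF hα hα' hz)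
  refine ⟨⟨fun z hz => (hd z hz).differentiableAt.differentiableWithinAt, by simp [extremalFun], ?_⟩,
    fun z => z, ⟨differentiableOn_id, rfl, fun z hz => hz⟩, fun z hz => ?_⟩
  · simpa [extremalF_zero] using (hd 0 (by simp [unitDisc])).deriv
  · unfold starQuotSubOne boothF
    split_ifs with h
    · simp [h]
    · have := extremalF_ne_zero hα' hz
      rw [(hd z hz).deriv, extremalFun, mul_div_mul_left _ _ h]
      field_simp
      ring

theorem extremalF_ofReal {α r : ℝ} (hα' : α < 1) (hr0 : 0 ≤ r) (hr : r < 1) :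
    extremalF α r = upperBoundBS α r := by
  have h := upperBoundBS_base_pos hα' hr0 hr
  have := Real.sqrt_nonneg α
  unfold extremalF upperBoundBS
  split_ifs
  · simp
  · rw [Complex.ofReal_cpow (by positivity)]
    push_cast
    rfl

theorem extremalF_neg_ofReal {α r : ℝ} (hα' : α < 1) (hr0 : 0 ≤ r) (hr : r < 1) :
    extremalF α (-(r : ℂ)) = lowerBoundBS α r := by
  have h := upperBoundBS_base_pos hα' hr0 hr
  have := Real.sqrt_nonneg α
  unfold extremalF lowerBoundBS
  split_ifs
  · simp
  · rw [Complex.ofReal_cpow (by positivity)]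
    push_cast
    rw [neg_mul, sub_neg_eq_add, ← sub_eq_add_neg]

/-! ### From support functions to the two bounds -/

/-- Integration along a ray: the support function of the values of `g` on `‖z‖ = r`. -/
theorem re_mul_log_le {α r : ℝ} (hα : 0 ≤ α) (hα' : α ≤ 1 / 5) {g k : ℂ → ℂ} (hg0 : g 0 = 0)
    (hg : ∀ z ∈ unitDisc, HasDerivAt g (k z) z)
    (hk : ∀ z ∈ unitDisc, ∃ ζ : ℂ, ‖ζ‖ ≤ ‖z‖ ∧ z * k z = boothF α ζ)
    {z : ℂ} (hz : ‖z‖ = r) (hr : r < 1) {c : ℂ} (hc : ‖c‖ = 1) :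
    (c * g z).re ≤ |c.re| * (Real.log (upperBoundBS α r) - r) + r := by
  have hr0 : 0 ≤ r := hz ▸ norm_nonneg z
  have hnorm : ∀ t ∈ Set.Icc (0 : ℝ) 1, ‖(t : ℂ) * z‖ = t * r := fun t ht => by
    rw [norm_mul, Complex.norm_real, Real.norm_of_nonneg ht.1, hz]
  have htr : ∀ t ∈ Set.Icc (0 : ℝ) 1, t * r < 1 := fun t ht =>
    (mul_le_of_le_one_left hr0 ht.2).trans_lt hr
  have hmem : ∀ t ∈ Set.Icc (0 : ℝ) 1, (t : ℂ) * z ∈ unitDisc := fun t ht => by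
    change ‖(t : ℂ) * z‖ < 1
    rw [hnorm t ht]
    exact htr t ht
  have hd : ∀ t ∈ Set.Icc (0 : ℝ) 1, HasDerivAt
      (fun t : ℝ => |c.re| * (Real.log (upperBoundBS α (t * r)) - t * r) + t * r -
        (c * g (t * z)).re)
      (|c.re| * (r * (1 / (1 - α * (t * r) ^ 2) - 1)) + r - (c * (z * k (t * z))).re) t := by
    intro t ht
    have hlin : HasDerivAt (fun t : ℝ => t * r) r t := by
      simpa using (hasDerivAt_id t).mul_const r
    have h1 : HasDerivAt (fun t : ℝ => Real.log (upperBoundBS α (t * r)))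
        (1 / (1 - α * (t * r) ^ 2) * r) t :=
      HasDerivAt.comp (h₂ := fun r => Real.log (upperBoundBS α r)) t
        (hasDerivAt_log_upperBoundBS hα (by linarith) (mul_nonneg ht.1 hr0) (htr t ht)) hlin
    have h2 : HasDerivAt (fun s : ℂ => c * g (s * z)) (c * (z * k (t * z))) (t : ℂ) := by
      have hl : HasDerivAt (fun s : ℂ => s * z) z (t : ℂ) := by
        simpa using (hasDerivAt_id (t : ℂ)).mul_const z
      have := ((hg _ (hmem t ht)).comp (t : ℂ) hl).const_mul c
      rwa [mul_comm (k _) z] at this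
    convert! (((h1.sub hlin).const_mul |c.re|).add hlin).sub h2.real_of_complex using 1
    ring
  have hm : MonotoneOn (fun t : ℝ => |c.re| * (Real.log (upperBoundBS α (t * r)) - t * r) + t * r -
      (c * g (t * z)).re) (Set.Icc (0 : ℝ) 1) := by
    apply monotoneOn_of_deriv_nonneg (convex_Icc 0 1)
    · exact fun t ht => (hd t ht).continuousAt.continuousWithinAt
    · exact fun t ht => (hd t (interior_subset ht)).differentiableAt.differentiableWithinAt
    · intro t ht
      have htI := interior_subset ht
      rw [interior_Icc] at ht
      rw [(hd t htI).deriv]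
      obtain ⟨ζ, hζ, hζk⟩ := hk _ (hmem t htI)
      rw [hnorm t htI] at hζ
      have hb := boothF_re_im_bound hα hα' hζ (htr t htI) hc
      have e : c * boothF α ζ = (t : ℂ) * (c * (z * k (t * z))) := by rw [← hζk]; ring
      rw [e, Complex.re_ofReal_mul] at hb
      -- The bound controls `t` times the integrand; `t > 0` in the interior allows cancelling it.
      refine nonneg_of_mul_nonneg_right (a := t) ?_ ht.1
      linarith
  have := hm ⟨le_rfl, zero_le_one⟩ ⟨zero_le_one, le_rfl⟩ zero_le_one
  simp only [zero_mul, one_mul, Complex.ofReal_zero, Complex.ofReal_one, hg0, mul_zero,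
    log_upperBoundBS_zero, Complex.zero_re, sub_zero, add_zero] at this
  linarith

/-- If `w` satisfies the support inequalities of a translate of a disc of radius `r ≤ 1` in the
directions of the left half-plane, then `exp (-L) ≤ Re (exp w)`. -/
theorem exp_neg_le_re_exp {w : ℂ} {L r : ℝ} (hr : r ≤ 1)
    (h : ∀ c : ℂ, ‖c‖ = 1 → (c * w).re ≤ |c.re| * (L - r) + r) :
    Real.exp (-L) ≤ (Complex.exp w).re := by
  have hy : |w.im| ≤ r := by
    rw [abs_le]
    have h1 := h Complex.I (by simp)
    have h2 := h (-Complex.I) (by simp)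
    simp at h1 h2
    constructor <;> linarith
  set y := |w.im| with hydef
  have hy0 : 0 ≤ y := abs_nonneg _
  have hy1 : y ≤ 1 := hy.trans hr
  have hcos : 0 < Real.cos y :=
    Real.cos_pos_of_mem_Ioo ⟨by linarith [Real.pi_gt_three], by linarith [Real.pi_gt_three]⟩
  -- The direction `-exp (i Im w)` is normal to the curve `Re (exp w) = exp (-L)` at height `Im w`.
  have hsupp : -w.re * Real.cos y + y * Real.sin y ≤ Real.cos y * (L - r) + r := by
    have hn : ‖-Complex.exp ((w.im : ℂ) * Complex.I)‖ = 1 := by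
      rw [norm_neg, Complex.norm_exp_ofReal_mul_I]
    have := h _ hn
    rw [Complex.mul_re, Complex.neg_re, Complex.neg_im, Complex.exp_ofReal_mul_I_re,
      Complex.exp_ofReal_mul_I_im, abs_neg] at this
    have e1 : Real.cos y = Real.cos w.im := Real.cos_abs _
    have e2 : y * Real.sin y = w.im * Real.sin w.im := by
      rcases abs_choice w.im with e | e <;> rw [hydef, e]
      rw [Real.sin_neg]; ring
    rw [← e1, abs_of_pos hcos] at this
    linarith
  have hlog := cos_mul_log_cos_add_nonneg hy0 hy1
  have hr' : r * (1 - Real.cos y) ≤ 1 - Real.cos y :=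
    mul_le_of_le_one_left (by linarith [Real.cos_le_one y]) hr
  have hle : -L ≤ w.re + Real.log (Real.cos y) := by
    have : 0 ≤ Real.cos y * (w.re + Real.log (Real.cos y) + L) := by linarith
    linarith [nonneg_of_mul_nonneg_right this hcos]
  rw [Complex.exp_re, ← Real.cos_abs w.im]
  calc Real.exp (-L) ≤ Real.exp (w.re + Real.log (Real.cos y)) := Real.exp_le_exp.mpr hle
    _ = Real.exp w.re * Real.cos y := by rw [Real.exp_add, Real.exp_log hcos]

theorem mainTheorem1 (α : ℝ) (hα_nonneg : 0 ≤ α) (hα_le : α ≤ 3 - 2 * Real.sqrt 2) :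
    (∀ f ∈ BS α, ∀ (z : ℂ) (r : ℝ), ‖z‖ = r → r < 1 →
      lowerBoundBS α r ≤ (quotByZ f z).re ∧ (quotByZ f z).re ≤ upperBoundBS α r) ∧
    extremalFun α ∈ BS α ∧
    (∀ r : ℝ, 0 ≤ r → r < 1 →
      (quotByZ (extremalFun α) (-(r : ℂ))).re = lowerBoundBS α r ∧
      (quotByZ (extremalFun α) (r : ℂ)).re = upperBoundBS α r) := by
  have hα : α ≤ 1 / 5 := by
    -- `3 - 2 * 1.4 = 1/5`, a rational threshold that still suffices.
    have : (1.4 : ℝ) ≤ Real.sqrt 2 := Real.le_sqrt_of_sq_le (by norm_num)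
    linarith
  have hα1 : α < 1 := by linarith
  refine ⟨fun f hf z r hz hr => ?_, extremalFun_mem_BS hα_nonneg hα1, fun r hr0 hr => ?_⟩
  · have hr0 : 0 ≤ r := hz ▸ norm_nonneg z
    obtain ⟨g, k, hg0, hg, hq, hk⟩ := BS.exists_log hα_nonneg hα1 hf
    have hU := upperBoundBS_pos hα1 hr0 hr
    have hsupp : ∀ c : ℂ, ‖c‖ = 1 →
        (c * g z).re ≤ |c.re| * (Real.log (upperBoundBS α r) - r) + r :=
      fun c hc => re_mul_log_le hα_nonneg hα hg0 hg hk hz hr hc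
    rw [hq z (show ‖z‖ < 1 from hz ▸ hr)]
    constructor
    · have := exp_neg_le_re_exp hr.le hsupp
      rwa [Real.exp_neg, Real.exp_log hU, ← lowerBoundBS_eq_inv hα1 hr0 hr] at this
    · have h1 := hsupp 1 norm_one
      simp only [one_mul, Complex.one_re, abs_one, sub_add_cancel] at h1
      calc (Complex.exp (g z)).re ≤ ‖Complex.exp (g z)‖ := Complex.re_le_norm _
        _ = Real.exp (g z).re := Complex.norm_exp _
        _ ≤ Real.exp (Real.log (upperBoundBS α r)) := Real.exp_le_exp.mpr h1
        _ = upperBoundBS α r := Real.exp_log hU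
  · rw [quotByZ_extremalFun hα_nonneg hα1, quotByZ_extremalFun hα_nonneg hα1,
      extremalF_ofReal hα1 hr0 hr, extremalF_neg_ofReal hα1 hr0 hr]
    exact ⟨Complex.ofReal_re _, Complex.ofReal_re _⟩
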